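/- Let $d\ge 1$ be an integer, $p>1$, and let $|n|=|n_1|+\dots+|n_d|$ and $\langle n\rangle=(|n|^2+1)^{1/2}$ for $n\in\mathbb Z^d$. Let $J:\{0,1,2,\dots\}\to[0,\infty)$ satisfy $J_0=0$ and $\sum_{m\in\mathbb Z^d}J_{|m|}<\infty$, and put $(Lu)_n=\sum_{m\ne n}J_{|n-m|}(u_n-u_m)$. Say that $J$ is of order $\alpha\in(0,\infty)$ if $\lim_{k\to\infty}k^{d+\alpha}J_k$ exists and lies in $(0,\infty)$, and of order $\infty$ if $\lim_{k\to\infty}k^{d+a}J_k=0$ for every real $a$. Let $\omega>0$, and consider solutions $q\in l^2(\mathbb Z^d;\mathbb C)$ of $$-\omega q_n=(Lq)_n-|q_n|^{p-1}q_n\qquad(n\in\mathbb Z^d)$$ with mass $\nu=\sum_n|q_n|^2>0$; when $q$ has non-negative entries this is the ground-state equation $-\omega q=Lq-q^p$. 1. Let $J$ be of order $\alpha\in(0,\infty)$. For every solution $q$ there is a constant $C$ with $$|q_n|\le C\,\nu^{p/2}\,\langle n\rangle^{-(d+\alpha)}\qquad\text{for all }n\in\mathbb Z^d .$$ Moreover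 $C$ depends on $q$ only through a radius outside which $q$ is small: there is $\varepsilon_0>0$, depending only on $d,p,J,\omega,\alpha$, such that for each $R$ one constant $C=C(d,p,J,\omega,\alpha,R)$ serves for all $\nu>0$ and all solutions $q$ of mass $\nu$ with $|q_n|\le\varepsilon_0$ whenever $|n|>R$. 2. Let $J$ be of order $\alpha\in(0,\infty)$ and let $q$ be a solution with mass $\nu>0$ and non-negative entries. Then $q\notin O(|n|^{-(d+\alpha+\epsilon)})$ as $|n|\to\infty$, for every $\epsilon>0$. 3. Let $J$ be of order $\infty$. Then every solution $q$ decays faster than any power: there is a constant $C$, independent of $\beta$, such that for every $\beta>0$ one has $|q_n|\le C|n|^{-\beta}$ for all sufficiently large $|n|$ (how large may depend on $\beta$). -/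

import Mathlib

open Filter Topology Asymptotics

noncomputable section

/-- The `l¹` length `|n| = |n₁| + ⋯ + |n_d|` of a lattice site. -/
def latticeLen {d : ℕ} (n : Fin d → ℤ) : ℕ := ∑ i, (n i).natAbs

/-- The Japanese bracket `⟨n⟩ = (|n|² + 1)^{1/2}`. -/
def bracket {d : ℕ} (n : Fin d → ℤ) : ℝ := Real.sqrt ((latticeLen n : ℝ) ^ 2 + 1)

/-- A radial coupling on `ℤ^d`: `J : ℕ → [0,∞)` with `J 0 = 0` and `∑_{m ∈ ℤ^d} J_{|m|} < ∞`. -/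
structure IsRadialCoupling (d : ℕ) (J : ℕ → ℝ) : Prop where
  zero : J 0 = 0
  nonneg : ∀ k, 0 ≤ J k
  summable : Summable fun m : Fin d → ℤ => J (latticeLen m)

/-- `J` is of finite order `α`: `k^{d+α} J_k` converges to a limit in `(0,∞)`. -/
def HasOrder (d : ℕ) (J : ℕ → ℝ) (α : ℝ) : Prop :=
  ∃ A : ℝ, 0 < A ∧ Tendsto (fun k : ℕ => (k : ℝ) ^ ((d : ℝ) + α) * J k) atTop (𝓝 A)

/-- `J` is of order `∞`: `k^{d+α} J_k → 0` for every `α < ∞`. -/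
def HasOrderInfinity (d : ℕ) (J : ℕ → ℝ) : Prop :=
  ∀ α : ℝ, Tendsto (fun k : ℕ => (k : ℝ) ^ ((d : ℝ) + α) * J k) atTop (𝓝 0)

/-- The coupling operator `(L u)_n = ∑_{m ≠ n} J_{|n-m|} (u_n - u_m)`; the term `m = n`, which is
included in the sum below, is zero. -/
def couplingOp {d : ℕ} (J : ℕ → ℝ) (u : (Fin d → ℤ) → ℂ) (n : Fin d → ℤ) : ℂ :=
  ∑' m : Fin d → ℤ, (J (latticeLen (n - m)) : ℂ) * (u n - u m)

/-- The mass `M[u] = ∑_n |u_n|²`. -/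
def mass {d : ℕ} (u : (Fin d → ℤ) → ℂ) : ℝ := ∑' n, ‖u n‖ ^ 2

/-- The stationary equation `-ω q = L q - |q|^{p-1} q` on `ℤ^d`; for `q` with non-negative entries
it reads `-ω q = L q - q^p`. -/
def SolvesStationary {d : ℕ} (J : ℕ → ℝ) (p ω : ℝ) (q : (Fin d → ℤ) → ℂ) : Prop :=
  ∀ n, -(ω : ℂ) * q n = couplingOp J q n - ((‖q n‖ ^ (p - 1) : ℝ) : ℂ) * q n

/-- All entries of `q` are non-negative real numbers. -/
def HasNonnegEntries {d : ℕ} (q : (Fin d → ℤ) → ℂ) : Prop :=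
  ∀ n, 0 ≤ (q n).re ∧ (q n).im = 0

end

/-! ### The lattice length -/

/-! With `S = ∑ J_{|m|}`, the equation reads `(S + ω) q = J * q + |q|^{p-1} q`, so `‖q‖` satisfies
`(S + ω) ‖q‖ ≤ J * ‖q‖ + ‖q‖^p`. Where `‖q‖ ≤ (ω/2)^{1/(p-1)}`, the power is at most `(ω/2) ‖q‖` and
is absorbed on the left. On the remaining ball it is at most `ν^{p/2}`, which a multiple of a
positive weight dominates.

The weight is `W = (ρ + |n|)^{-s}`. For large `ρ` it satisfies `J * W ≤ (S + ω/4) W`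
(`exists_supersolution`), and comparison through a maximum principle (`nonpos_of_subsolution`) gives
`‖q‖ ≤ M W` in `exists_decay`, with `M` proportional to `ν^{p/2}`. Finite order uses `s = d + α`;
infinite order allows every `s > d`.

For sharpness, non-negativity rules out cancellation, so one term of `J * q` already forces `q` to
decay no faster than `J`. -/

lemma latticeLen_le_add {d : ℕ} (n m : Fin d → ℤ) :
    latticeLen n ≤ latticeLen (n - m) + latticeLen m := by
  unfold latticeLen
  rw [← Finset.sum_add_distrib]
  refine Finset.sum_le_sum fun i _ => ?_
  simp only [Pi.sub_apply]
  omega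

lemma latticeLen_single {d : ℕ} (i : Fin d) (k : ℤ) :
    latticeLen (Pi.single i k) = k.natAbs := by
  unfold latticeLen
  rw [Finset.sum_eq_single i]
  · simp
  · intro j _ hj
    simp [Pi.single_eq_of_ne hj]
  · simp

lemma natAbs_le_latticeLen {d : ℕ} (n : Fin d → ℤ) (i : Fin d) :
    (n i).natAbs ≤ latticeLen n :=
  Finset.single_le_sum (f := fun i => (n i).natAbs) (fun _ _ => Nat.zero_le _)
    (Finset.mem_univ i)

lemma finite_latticeLen_le (d N : ℕ) : {n : Fin d → ℤ | latticeLen n ≤ N}.Finite := by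
  refine (Set.finite_Icc (fun _ : Fin d => -(N : ℤ)) (fun _ => (N : ℤ))).subset fun n hn => ?_
  have hn' : latticeLen n ≤ N := hn
  constructor <;> intro i <;> have := natAbs_le_latticeLen n i <;> dsimp only <;> omega

lemma tendsto_latticeLen (d : ℕ) :
    Tendsto (fun n : Fin d → ℤ => latticeLen n) cofinite atTop := by
  refine tendsto_atTop.2 fun N => ?_
  refine (finite_latticeLen_le d N).subset fun n hn => ?_
  simp only [Set.mem_compl_iff, Set.mem_ofPred_eq, not_le] at hn
  exact hn.le

lemma bracket_le_add {d : ℕ} (n : Fin d → ℤ) {ρ : ℝ} (hρ : 1 ≤ ρ) :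
    bracket n ≤ ρ + latticeLen n := by
  have h : (0 : ℝ) ≤ latticeLen n := Nat.cast_nonneg _
  exact Real.sqrt_le_iff.2 ⟨by positivity, by nlinarith⟩

lemma bracket_pos {d : ℕ} (n : Fin d → ℤ) : 0 < bracket n :=
  Real.sqrt_pos.2 (by positivity)

lemma summable_latticeLen_rpow (d : ℕ) {s : ℝ} (hs : (d : ℝ) < s) :
    Summable fun n : Fin d → ℤ => (1 + (latticeLen n : ℝ)) ^ (-s) := by
  let b := Pi.basisFun ℝ (Fin d)
  let L : Submodule ℤ (Fin d → ℝ) := Submodule.span ℤ (Set.range b)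
  let e : (Fin d → ℤ) → L := fun n => (b.restrictScalars ℤ).equivFun.symm n
  have he : ∀ n i, (e n : Fin d → ℝ) i = n i := by
    intro n i
    simp [e, b, Module.Basis.equivFun_symm_apply, Finset.sum_apply, Pi.single_apply]
  have hinj : Function.Injective e := (b.restrictScalars ℤ).equivFun.symm.injective
  have hfr : Module.finrank ℤ L = d := by
    rw [Module.finrank_eq_card_basis (b.restrictScalars ℤ)]
    simp
  have hsum : Summable fun z : L => ‖z‖ ^ (-s) := by
    refine ZLattice.summable_norm_rpow L (-s) ?_
    rw [hfr]
    linarith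
  have hs0 : 0 < s := lt_of_le_of_lt (Nat.cast_nonneg d) hs
  refine Summable.of_norm_bounded_eventually (hsum.comp_injective hinj) ?_
  -- The comparison fails only at the origin, where `‖0‖ ^ (-s)` takes the default value `0`.
  refine (Set.finite_singleton (0 : Fin d → ℤ)).subset fun n hn => ?_
  by_contra hn0
  refine hn ?_
  have hpos : 0 < ‖e n‖ := by
    refine norm_pos_iff.2 fun h => hn0 ?_
    ext i
    have h' : (n i : ℝ) = 0 := by
      rw [← he, h]
      rfl
    exact_mod_cast h'
  have hle : ‖e n‖ ≤ 1 + (latticeLen n : ℝ) := by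
    refine (pi_norm_le_iff_of_nonneg (by positivity)).2 fun i => ?_
    change ‖(e n : Fin d → ℝ) i‖ ≤ _
    rw [he, Real.norm_eq_abs, ← Int.cast_abs, ← Nat.cast_natAbs]
    have : ((n i).natAbs : ℝ) ≤ latticeLen n := by exact_mod_cast natAbs_le_latticeLen n i
    linarith
  change ‖(1 + (latticeLen n : ℝ)) ^ (-s)‖ ≤ ‖e n‖ ^ (-s)
  rw [Real.norm_of_nonneg (by positivity)]
  exact Real.rpow_le_rpow_of_nonpos hpos hle (by linarith)

lemma summable_add_latticeLen_rpow (d : ℕ) {s ρ : ℝ} (hs : (d : ℝ) < s) (hρ : 1 ≤ ρ) :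
    Summable fun n : Fin d → ℤ => (ρ + (latticeLen n : ℝ)) ^ (-s) := by
  have hs0 : 0 < s := lt_of_le_of_lt (Nat.cast_nonneg d) hs
  refine Summable.of_nonneg_of_le (fun n => by positivity) (fun n => ?_)
    (summable_latticeLen_rpow d hs)
  exact Real.rpow_le_rpow_of_nonpos (by positivity) (by linarith) (by linarith)

lemma tendsto_tsum_add_latticeLen_rpow (d : ℕ) {s : ℝ} (hs : (d : ℝ) < s) :
    Tendsto (fun ρ : ℝ => ∑' n : Fin d → ℤ, (ρ + (latticeLen n : ℝ)) ^ (-s)) atTop (𝓝 0) := by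
  have hs0 : 0 < s := lt_of_le_of_lt (Nat.cast_nonneg d) hs
  have h := tendsto_tsum_of_dominated_convergence (𝓕 := atTop)
    (f := fun (ρ : ℝ) (n : Fin d → ℤ) => (ρ + (latticeLen n : ℝ)) ^ (-s))
    (g := fun _ => (0 : ℝ)) (summable_latticeLen_rpow d hs)
    (fun n => (tendsto_rpow_neg_atTop hs0).comp (tendsto_atTop_add_const_right _ _ tendsto_id))
    (by
      filter_upwards [eventually_ge_atTop 1] with ρ hρ n
      rw [Real.norm_of_nonneg (by positivity)]
      exact Real.rpow_le_rpow_of_nonpos (by positivity) (by linarith) (by linarith))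
  simpa using h

/-! ### Convolution with the coupling -/

namespace IsRadialCoupling

variable {d : ℕ} {J : ℕ → ℝ}

lemma summable_sub (hJ : IsRadialCoupling d J) (n : Fin d → ℤ) :
    Summable fun m : Fin d → ℤ => J (latticeLen (n - m)) :=
  (Equiv.subLeft n).summable_iff (f := fun m : Fin d → ℤ => J (latticeLen m)) |>.2 hJ.summable

lemma tsum_sub (n : Fin d → ℤ) :
    ∑' m : Fin d → ℤ, J (latticeLen (n - m)) = ∑' m : Fin d → ℤ, J (latticeLen m) :=
  (Equiv.subLeft n).tsum_eq fun m : Fin d → ℤ => J (latticeLen m)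

lemma tsum_nonneg (hJ : IsRadialCoupling d J) : 0 ≤ ∑' m : Fin d → ℤ, J (latticeLen m) :=
  _root_.tsum_nonneg fun _ => hJ.nonneg _

lemma summable_mul (hJ : IsRadialCoupling d J) (n : Fin d → ℤ) {f : (Fin d → ℤ) → ℝ} {B : ℝ}
    (hf : ∀ m, |f m| ≤ B) : Summable fun m => J (latticeLen (n - m)) * f m := by
  refine Summable.of_norm_bounded ((hJ.summable_sub n).mul_right B) fun m => ?_
  rw [norm_mul, Real.norm_of_nonneg (hJ.nonneg _)]
  exact mul_le_mul_of_nonneg_left (hf m) (hJ.nonneg _)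

/-- A bounded subsolution of `(S + κ) b = J * b`, with `κ > 0` and `S` the total mass of `J`,
is nonpositive. -/
lemma nonpos_of_subsolution (hJ : IsRadialCoupling d J) {κ B : ℝ} (hκ : 0 < κ)
    {b : (Fin d → ℤ) → ℝ} (hb : ∀ n, |b n| ≤ B)
    (hsub : ∀ n, (∑' m : Fin d → ℤ, J (latticeLen m) + κ) * b n ≤
      ∑' m, J (latticeLen (n - m)) * b m) (n : Fin d → ℤ) : b n ≤ 0 := by
  have hS := hJ.tsum_nonneg
  set S := ∑' m : Fin d → ℤ, J (latticeLen m)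
  have hbdd : BddAbove (Set.range b) :=
    ⟨B, by rintro _ ⟨m, rfl⟩; exact (le_abs_self _).trans (hb m)⟩
  have hle : ∀ n, (S + κ) * b n ≤ S * ⨆ m, b m := by
    intro n
    refine (hsub n).trans ?_
    calc ∑' m, J (latticeLen (n - m)) * b m
        ≤ ∑' m, J (latticeLen (n - m)) * ⨆ m, b m :=
          (hJ.summable_mul n hb).tsum_le_tsum
            (fun m => mul_le_mul_of_nonneg_left (le_ciSup hbdd m) (hJ.nonneg _))
            ((hJ.summable_sub n).mul_right _)
      _ = S * ⨆ m, b m := by rw [tsum_mul_right, tsum_sub]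
  -- The supremum need not be attained: taking it on the left gives `(S + κ) sup b ≤ S sup b`, hence
  -- `κ sup b ≤ 0`.
  have hsup : (⨆ m, b m) ≤ (S * ⨆ m, b m) / (S + κ) :=
    ciSup_le fun n => (le_div_iff₀' (by positivity)).2 (hle n)
  rw [le_div_iff₀ (by positivity)] at hsup
  have : (⨆ m, b m) ≤ 0 := by nlinarith
  exact (le_ciSup hbdd n).trans this

/-- For large `ρ` the weight `(ρ + |n|)^{-s}` is nearly a supersolution for convolution with a
coupling that decays at the rate `s`. -/
lemma exists_supersolution (hJ : IsRadialCoupling d J) {s A δ : ℝ} (hs : (d : ℝ) < s)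
    (hA : ∀ k, J k ≤ A * (k : ℝ) ^ (-s)) (hδ : 0 < δ) :
    ∃ ρ : ℝ, 1 ≤ ρ ∧ ∀ n : Fin d → ℤ,
      ∑' m : Fin d → ℤ, J (latticeLen (n - m)) * (ρ + (latticeLen m : ℝ)) ^ (-s) ≤
        (∑' m : Fin d → ℤ, J (latticeLen m) + δ) * (ρ + (latticeLen n : ℝ)) ^ (-s) := by
  have hs0 : 0 < s := lt_of_le_of_lt (Nat.cast_nonneg d) hs
  have hS := hJ.tsum_nonneg
  set S := ∑' m : Fin d → ℤ, J (latticeLen m)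
  have hA0 : 0 ≤ A := by
    have := (hJ.nonneg 1).trans (hA 1)
    simpa using this
  -- The sum over `m` is split at `ρ + |m| = (1 - l)(ρ + |n|)`. Above it, `W m` exceeds `W n` by a
  -- factor of at most `(1 - l)^{-s}`, close to `1` for small `l`.
  obtain ⟨l, hl0, hl1, hl⟩ : ∃ l : ℝ, 0 < l ∧ l < 1 ∧ (1 - l) ^ (-s) * S < S + δ / 2 := by
    have hcont : ContinuousAt (fun l : ℝ => (1 - l) ^ (-s) * S) 0 := by
      refine ContinuousAt.mul ?_ continuousAt_const
      exact (continuousAt_const.sub continuousAt_id).rpow_const (Or.inl (by simp))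
    have h1 : ∀ᶠ l : ℝ in 𝓝[>] 0, (1 - l) ^ (-s) * S < S + δ / 2 := by
      refine nhdsWithin_le_nhds (hcont.eventually_lt continuousAt_const ?_)
      simp [hδ]
    have h2 : ∀ᶠ l : ℝ in 𝓝[>] 0, l ∈ Set.Ioo (0 : ℝ) 1 := Ioo_mem_nhdsGT one_pos
    obtain ⟨l, h, h'⟩ := (h1.and h2).exists
    exact ⟨l, h'.1, h'.2, h⟩
  -- Below the split, `|n - m| ≥ l (ρ + |n|)`, so `J` itself supplies the factor `W n`; what is left
  -- is a multiple of `∑ W`, small for large `ρ`.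
  have hlim : ∀ᶠ ρ : ℝ in atTop,
      A * l ^ (-s) * ∑' n : Fin d → ℤ, (ρ + (latticeLen n : ℝ)) ^ (-s) < δ / 2 := by
    have := (tendsto_tsum_add_latticeLen_rpow d hs).const_mul (A * l ^ (-s))
    rw [mul_zero] at this
    exact this.eventually_lt_const (by positivity)
  obtain ⟨ρ, hρ, hρ1⟩ := (hlim.and (eventually_ge_atTop 1)).exists
  refine ⟨ρ, hρ1, fun n => ?_⟩
  set W : (Fin d → ℤ) → ℝ := fun m => (ρ + (latticeLen m : ℝ)) ^ (-s) with hW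
  have hWpos : ∀ m, 0 < W m := fun m => by simp only [hW]; positivity
  have hWsum : Summable W := summable_add_latticeLen_rpow d hs hρ1
  have hpt : ∀ m, J (latticeLen (n - m)) * W m ≤
      J (latticeLen (n - m)) * ((1 - l) ^ (-s) * W n) + A * l ^ (-s) * W n * W m := by
    intro m
    have hx : 0 < ρ + (latticeLen n : ℝ) := by positivity
    have hl1' : 0 < 1 - l := by linarith
    by_cases hc : (1 - l) * (ρ + (latticeLen n : ℝ)) ≤ ρ + (latticeLen m : ℝ)
    · have h1 : W m ≤ (1 - l) ^ (-s) * W n := by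
        simp only [hW]
        rw [← Real.mul_rpow hl1'.le hx.le]
        exact Real.rpow_le_rpow_of_nonpos (by positivity) hc (by linarith)
      have h2 := mul_le_mul_of_nonneg_left h1 (hJ.nonneg (latticeLen (n - m)))
      have h3 : 0 ≤ A * l ^ (-s) * W n * W m := by
        have := (hWpos n).le
        have := (hWpos m).le
        positivity
      linarith
    · have htri : (latticeLen n : ℝ) ≤ latticeLen (n - m) + latticeLen m := by
        exact_mod_cast latticeLen_le_add n m
      have hfar : l * (ρ + (latticeLen n : ℝ)) ≤ latticeLen (n - m) := by
        push Not at hc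
        linarith
      have h1 : J (latticeLen (n - m)) ≤ A * l ^ (-s) * W n := by
        refine (hA _).trans ?_
        simp only [hW]
        rw [mul_assoc, ← Real.mul_rpow hl0.le hx.le]
        exact mul_le_mul_of_nonneg_left
          (Real.rpow_le_rpow_of_nonpos (by positivity) hfar (by linarith)) hA0
      have h2 := mul_le_mul_of_nonneg_right h1 (hWpos m).le
      have h3 : 0 ≤ J (latticeLen (n - m)) * ((1 - l) ^ (-s) * W n) := by
        have := hJ.nonneg (latticeLen (n - m))
        have := (hWpos n).le
        positivity
      linarith
  have hsum1 := (hJ.summable_sub n).mul_right ((1 - l) ^ (-s) * W n)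
  have hsum2 := hWsum.mul_left (A * l ^ (-s) * W n)
  have hbd : ∀ m, |W m| ≤ ∑' k, W k := fun m => by
    rw [abs_of_pos (hWpos m)]
    exact hWsum.le_tsum m fun k _ => (hWpos k).le
  calc ∑' m, J (latticeLen (n - m)) * W m
      ≤ ∑' m, (J (latticeLen (n - m)) * ((1 - l) ^ (-s) * W n) + A * l ^ (-s) * W n * W m) :=
        (hJ.summable_mul n hbd).tsum_le_tsum hpt (hsum1.add hsum2)
    _ = ((1 - l) ^ (-s) * S + A * l ^ (-s) * ∑' m, W m) * W n := by
        rw [hsum1.tsum_add hsum2, tsum_mul_right, tsum_mul_left, tsum_sub]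
        ring
    _ ≤ (S + δ) * W n :=
        mul_le_mul_of_nonneg_right (by linarith) (hWpos n).le

end IsRadialCoupling

lemma exists_le_rpow_of_tendsto {J : ℕ → ℝ} (h0 : J 0 = 0) {s A : ℝ}
    (h : Tendsto (fun k : ℕ => (k : ℝ) ^ s * J k) atTop (𝓝 A)) :
    ∃ B, ∀ k, J k ≤ B * (k : ℝ) ^ (-s) := by
  obtain ⟨B, hB⟩ := h.bddAbove_range
  -- The maximum with `0` keeps the bound non-negative at `k = 0`, where the limit gives no
  -- information on `J`.
  have hB' : ∀ k : ℕ, (k : ℝ) ^ s * J k ≤ max B 0 := fun k => (hB ⟨k, rfl⟩).trans (le_max_left _ _)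
  refine ⟨max B 0, fun k => ?_⟩
  rcases Nat.eq_zero_or_pos k with rfl | hk
  · rw [h0]
    positivity
  · have hk' : (0 : ℝ) < k := by exact_mod_cast hk
    rw [Real.rpow_neg hk'.le, ← div_eq_mul_inv, le_div_iff₀ (by positivity), mul_comm]
    exact hB' k

/-! ### Solutions of the stationary equation -/

lemma norm_rpow_le_mass_rpow {d : ℕ} (q : lp (fun _ : Fin d → ℤ => ℂ) 2) {p : ℝ} (hp : 0 < p)
    (n : Fin d → ℤ) : ‖q n‖ ^ p ≤ mass q ^ (p / 2) := by
  have hsum : Summable fun n => ‖q n‖ ^ 2 := by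
    have := (lp.memℓp q).summable (by norm_num)
    simpa using this
  have h : ‖q n‖ ^ 2 ≤ mass q := hsum.le_tsum n fun _ _ => by positivity
  calc ‖q n‖ ^ p = (‖q n‖ ^ 2) ^ (p / 2) := by
        rw [← Real.rpow_natCast, ← Real.rpow_mul (norm_nonneg _)]
        congr 1
        push_cast
        ring
    _ ≤ mass q ^ (p / 2) := Real.rpow_le_rpow (by positivity) h (by positivity)

lemma rpow_sub_one_mul_self {x p : ℝ} (hx : 0 ≤ x) (hp : 0 < p) : x ^ (p - 1) * x = x ^ p := by
  rw [← Real.rpow_add_one' hx (by linarith)]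
  simp

section Stationary

variable {d : ℕ} {J : ℕ → ℝ} {p ω : ℝ}

lemma SolvesStationary.eq_conv (hJ : IsRadialCoupling d J)
    {q : lp (fun _ : Fin d → ℤ => ℂ) 2} (hq : SolvesStationary J p ω q) (n : Fin d → ℤ) :
    ((∑' m : Fin d → ℤ, J (latticeLen m) + ω : ℝ) : ℂ) * q n =
      ∑' m, (J (latticeLen (n - m)) : ℂ) * q m + ((‖q n‖ ^ (p - 1) : ℝ) : ℂ) * q n := by
  have h := hq n
  have h1 : Summable fun m : Fin d → ℤ => (J (latticeLen (n - m)) : ℂ) * q n :=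
    (Complex.summable_ofReal.2 (hJ.summable_sub n)).mul_right _
  have h2 : Summable fun m : Fin d → ℤ => (J (latticeLen (n - m)) : ℂ) * q m := by
    refine Summable.of_norm ?_
    have := hJ.summable_mul n (f := fun m => ‖q m‖) (B := ‖q‖) fun m => by
      rw [abs_norm]
      exact lp.norm_apply_le_norm (by norm_num) q m
    refine this.congr fun m => ?_
    rw [norm_mul, Complex.norm_of_nonneg (hJ.nonneg _)]
  have h3 : couplingOp J q n = ((∑' m : Fin d → ℤ, J (latticeLen m) : ℝ) : ℂ) * q n -
      ∑' m, (J (latticeLen (n - m)) : ℂ) * q m := by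
    unfold couplingOp
    simp only [mul_sub]
    rw [h1.tsum_sub h2, tsum_mul_right, ← Complex.ofReal_tsum, IsRadialCoupling.tsum_sub]
  rw [h3] at h
  push_cast at h ⊢
  linear_combination -h

lemma SolvesStationary.norm_le_conv (hJ : IsRadialCoupling d J) (hp : 0 < p) (hω : 0 < ω)
    {q : lp (fun _ : Fin d → ℤ => ℂ) 2} (hq : SolvesStationary J p ω q) (n : Fin d → ℤ) :
    (∑' m : Fin d → ℤ, J (latticeLen m) + ω) * ‖q n‖ ≤
      ∑' m, J (latticeLen (n - m)) * ‖q m‖ + ‖q n‖ ^ p := by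
  have hS := hJ.tsum_nonneg
  have hsum := hJ.summable_mul n (f := fun m => ‖q m‖) (B := ‖q‖) fun m => by
    rw [abs_norm]
    exact lp.norm_apply_le_norm (by norm_num) q m
  have hnorm : ∀ m, ‖(J (latticeLen (n - m)) : ℂ) * q m‖ = J (latticeLen (n - m)) * ‖q m‖ :=
    fun m => by rw [norm_mul, Complex.norm_of_nonneg (hJ.nonneg _)]
  have h := congrArg norm (hq.eq_conv hJ n)
  rw [norm_mul, Complex.norm_of_nonneg (by positivity)] at h
  rw [h]
  refine (norm_add_le _ _).trans (add_le_add ?_ ?_)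
  · refine (norm_tsum_le_tsum_norm (hsum.congr fun m => (hnorm m).symm)).trans_eq ?_
    simp only [hnorm]
  · rw [norm_mul, Complex.norm_of_nonneg (by positivity),
      rpow_sub_one_mul_self (norm_nonneg _) hp]

/-- Decay of solutions at every rate `s > d` at which the coupling decays, with a constant that
depends on the solution only through a radius outside which it is small. -/
lemma SolvesStationary.exists_decay (hJ : IsRadialCoupling d J) (hp : 1 < p) (hω : 0 < ω)
    {s A : ℝ} (hs : (d : ℝ) < s) (hA : ∀ k, J k ≤ A * (k : ℝ) ^ (-s)) (R : ℝ) :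
    ∃ C : ℝ, ∀ q : lp (fun _ : Fin d → ℤ => ℂ) 2, SolvesStationary J p ω q →
      (∀ n : Fin d → ℤ, R < (latticeLen n : ℝ) → ‖q n‖ ≤ (ω / 2) ^ (p - 1)⁻¹) →
      ∀ n : Fin d → ℤ, ‖q n‖ ≤ C * mass q ^ (p / 2) * bracket n ^ (-s) := by
  have hs0 : 0 < s := lt_of_le_of_lt (Nat.cast_nonneg d) hs
  obtain ⟨ρ, hρ, hW⟩ := hJ.exists_supersolution hs hA (δ := ω / 4) (by positivity)
  have hS := hJ.tsum_nonneg
  set S := ∑' m : Fin d → ℤ, J (latticeLen m)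
  set W : (Fin d → ℤ) → ℝ := fun m => (ρ + (latticeLen m : ℝ)) ^ (-s) with hWdef
  have hWpos : ∀ m, 0 < W m := fun m => by simp only [hWdef]; positivity
  have hWle : ∀ m, |W m| ≤ 1 := fun m => by
    rw [abs_of_pos (hWpos m)]
    exact Real.rpow_le_one_of_one_le_of_nonpos
      (hρ.trans (le_add_of_nonneg_right (Nat.cast_nonneg _))) (by linarith)
  set K : ℝ := (ρ + max R 0) ^ s with hK
  have hρ0 : 0 < ρ + max R 0 := by positivity
  have hKpos : 0 < K := by positivity
  -- Since `K * W ≥ 1` on the ball of radius `R`, this constant makes `M (ω/4) W ≥ ν^{p/2} ≥ ‖q‖^p`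
  -- there.
  refine ⟨K / (ω / 4), fun q hq hsmall n => ?_⟩
  have hν : 0 ≤ mass q ^ (p / 2) :=
    Real.rpow_nonneg (tsum_nonneg fun _ => by positivity) _
  set M : ℝ := K / (ω / 4) * mass q ^ (p / 2) with hM
  have hM0 : 0 ≤ M := by positivity
  have hqb : ∀ m, |‖q m‖| ≤ ‖q‖ := fun m => by
    rw [abs_norm]
    exact lp.norm_apply_le_norm (by norm_num) q m
  have hMW : ∀ m, |M * W m| ≤ M := fun m => by
    rw [abs_mul, abs_of_nonneg hM0]
    exact mul_le_of_le_one_right hM0 (hWle m)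
  have key := hJ.nonpos_of_subsolution (κ := ω / 2) (B := ‖q‖ + M)
    (b := fun m => ‖q m‖ - M * W m) (by positivity)
    (fun m => (abs_sub _ _).trans (add_le_add (hqb m) (hMW m))) (fun k => by
      have hconv : ∑' m, J (latticeLen (k - m)) * (‖q m‖ - M * W m) =
          ∑' m, J (latticeLen (k - m)) * ‖q m‖ - M * ∑' m, J (latticeLen (k - m)) * W m := by
        rw [← tsum_mul_left, ← (hJ.summable_mul k hqb).tsum_sub
          (((hJ.summable_mul k hWle).mul_left M))]
        exact tsum_congr fun m => by ring
      rw [hconv]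
      have h1 := hq.norm_le_conv hJ (by linarith) hω k
      have h2 := mul_le_mul_of_nonneg_left (hW k) hM0
      -- The budget `ω` is spent as `ω/2` on the small nonlinearity, `ω/4` on the ball and `ω/4` on
      -- the error in the supersolution; this leaves `κ = ω/2` for `‖q‖ - M W`.
      have h3 : ‖q k‖ ^ p ≤ ω / 2 * ‖q k‖ + M * (ω / 4) * W k := by
        by_cases hk : R < (latticeLen k : ℝ)
        · have h4 : ‖q k‖ ^ (p - 1) ≤ ω / 2 := by
            have := Real.rpow_le_rpow (norm_nonneg _) (hsmall k hk)
              (show (0 : ℝ) ≤ p - 1 by linarith)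
            rwa [Real.rpow_inv_rpow (by positivity) (by linarith)] at this
          have h5 := mul_le_mul_of_nonneg_right h4 (norm_nonneg (q k))
          rw [rpow_sub_one_mul_self (norm_nonneg _) (by linarith)] at h5
          have h6 := mul_nonneg hM0 (hWpos k).le
          nlinarith
        · have h4 : 1 ≤ K * W k := by
            have h5 : (ρ + max R 0) ^ (-s) ≤ W k :=
              Real.rpow_le_rpow_of_nonpos (by positivity)
                (by linarith [le_max_left R 0]) (by linarith)
            have h6 := mul_le_mul_of_nonneg_left h5 hKpos.le
            rwa [hK, ← Real.rpow_add hρ0, add_neg_cancel, Real.rpow_zero] at h6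
          have h5 := norm_rpow_le_mass_rpow q (p := p) (by linarith) k
          have h6 : M * (ω / 4) * W k = mass q ^ (p / 2) * (K * W k) := by
            rw [hM]
            field_simp
          rw [h6]
          have h7 := mul_le_mul_of_nonneg_left h4 hν
          have h8 : 0 ≤ ω / 2 * ‖q k‖ := by positivity
          linarith
      nlinarith) n
  have hWb : W n ≤ bracket n ^ (-s) :=
    Real.rpow_le_rpow_of_nonpos (bracket_pos n) (bracket_le_add n hρ) (by linarith)
  have := mul_le_mul_of_nonneg_left hWb hM0
  dsimp only at key
  linarith

lemma exists_radius_norm_le (q : lp (fun _ : Fin d → ℤ => ℂ) 2) {ε : ℝ} (hε : 0 < ε) :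
    ∃ R : ℝ, ∀ n : Fin d → ℤ, R < (latticeLen n : ℝ) → ‖q n‖ ≤ ε := by
  have hsum : Summable fun n => ‖q n‖ ^ 2 := by
    have := (lp.memℓp q).summable (by norm_num)
    simpa using this
  have hev := hsum.tendsto_cofinite_zero.eventually_lt_const (show 0 < ε ^ 2 by positivity)
  obtain ⟨N, hN⟩ := (Set.Finite.image latticeLen hev).bddAbove
  refine ⟨N, fun n hn => ?_⟩
  by_contra hc
  push Not at hc
  have : latticeLen n ≤ N := hN ⟨n, fun h => absurd (abs_lt_of_sq_lt_sq h hε.le)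
    (by rw [abs_norm]; exact hc.le.not_gt), rfl⟩
  exact absurd hn (not_lt.2 (by exact_mod_cast this))

/-- Keeping only the summand at a site `m₀` with `q m₀ ≠ 0` gives `J_{|n-m₀|} q_{m₀} ≤ (S + ω) q_n`.
Faster decay along a coordinate ray from `m₀` would force `A ‖q m₀‖ ≤ 0`. -/
lemma SolvesStationary.not_isBigO (hd : 1 ≤ d) (hJ : IsRadialCoupling d J) (hω : 0 < ω) {s : ℝ}
    {A : ℝ} (hs : 0 < s) (hA : 0 < A)
    (hlim : Tendsto (fun k : ℕ => (k : ℝ) ^ s * J k) atTop (𝓝 A))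
    {q : lp (fun _ : Fin d → ℤ => ℂ) 2} (hq : SolvesStationary J p ω q) (hq0 : 0 < mass q)
    (hnn : HasNonnegEntries q) {ε : ℝ} (hε : 0 < ε) :
    ¬ ((fun n : Fin d → ℤ => q n) =O[cofinite]
        (fun n : Fin d → ℤ => (latticeLen n : ℝ) ^ (-(s + ε)))) := by
  intro hO
  have hS := hJ.tsum_nonneg
  set S := ∑' m : Fin d → ℤ, J (latticeLen m)
  have hre : ∀ n, q n = (‖q n‖ : ℂ) := fun n => by
    have h : q n = ((q n).re : ℂ) := Complex.ext rfl (by simp [(hnn n).2])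
    rw [h, Complex.norm_of_nonneg (hnn n).1]
  obtain ⟨m₀, hm₀⟩ : ∃ m, q m ≠ 0 := by
    by_contra! hc
    simp [mass, hc] at hq0
  have hm₀' : 0 < ‖q m₀‖ := norm_pos_iff.2 hm₀
  have hlow : ∀ n, J (latticeLen (n - m₀)) * ‖q m₀‖ ≤ (S + ω) * ‖q n‖ := by
    intro n
    have hsum := hJ.summable_mul n (f := fun m => ‖q m‖) (B := ‖q‖) fun m => by
      rw [abs_norm]
      exact lp.norm_apply_le_norm (by norm_num) q m
    have heq : (S + ω) * ‖q n‖ =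
        ∑' m, J (latticeLen (n - m)) * ‖q m‖ + ‖q n‖ ^ (p - 1) * ‖q n‖ := by
      have h := hq.eq_conv hJ n
      have hc : ∑' m, (J (latticeLen (n - m)) : ℂ) * q m =
          ((∑' m, J (latticeLen (n - m)) * ‖q m‖ : ℝ) : ℂ) := by
        rw [Complex.ofReal_tsum]
        refine tsum_congr fun m => ?_
        rw [Complex.ofReal_mul, ← hre]
      rw [hc] at h
      have h' : (((S + ω) * ‖q n‖ : ℝ) : ℂ) =
          ((∑' m, J (latticeLen (n - m)) * ‖q m‖ + ‖q n‖ ^ (p - 1) * ‖q n‖ : ℝ) : ℂ) := by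
        have hmul : ∀ r : ℝ, ((r * ‖q n‖ : ℝ) : ℂ) = (r : ℂ) * q n := fun r => by
          rw [Complex.ofReal_mul]
          exact congrArg _ (hre n).symm
        rw [Complex.ofReal_add, hmul, hmul]
        exact h
      exact_mod_cast h'
    rw [heq]
    have h1 := hsum.le_tsum m₀ fun m _ => mul_nonneg (hJ.nonneg _) (norm_nonneg _)
    have h2 : 0 ≤ ‖q n‖ ^ (p - 1) * ‖q n‖ := by positivity
    linarith
  obtain ⟨c, hc⟩ := hO.bound
  let i : Fin d := ⟨0, hd⟩
  let x : ℕ → (Fin d → ℤ) := fun k => m₀ + Pi.single i (k : ℤ)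
  have hxsub : ∀ k, latticeLen (x k - m₀) = k := fun k => by
    simp [x, latticeLen_single]
  have hxinj : Function.Injective x := fun a b hab => by
    have := congrArg (fun y => latticeLen (y - m₀)) hab
    simpa only [hxsub] using this
  have hxlen : ∀ k : ℕ, (k : ℝ) - latticeLen m₀ ≤ latticeLen (x k) := fun k => by
    have h := latticeLen_le_add (x k - m₀) (-m₀)
    have hneg : latticeLen (-m₀) = latticeLen m₀ := by simp [latticeLen]
    rw [hxsub, hneg, sub_neg_eq_add, sub_add_cancel] at h
    have : (k : ℝ) ≤ latticeLen (x k) + latticeLen m₀ := by exact_mod_cast h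
    linarith
  have hev := hxinj.tendsto_cofinite.eventually hc
  rw [Nat.cofinite_eq_atTop] at hev
  -- This threshold gives `k > 0` and `|x k| ≥ k - |m₀| ≥ k / 2`.
  have hev2 : ∀ᶠ k : ℕ in atTop, (2 * latticeLen m₀ + 1 : ℕ) ≤ k := eventually_ge_atTop _
  have hlim2 : Tendsto (fun k : ℕ => (S + ω) * |c| * (1 / 2 : ℝ) ^ (-(s + ε)) * (k : ℝ) ^ (-ε))
      atTop (𝓝 0) := by
    have := ((tendsto_rpow_neg_atTop hε).comp tendsto_natCast_atTop_atTop).const_mul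
      ((S + ω) * |c| * (1 / 2 : ℝ) ^ (-(s + ε)))
    simpa using this
  have hfin := le_of_tendsto_of_tendsto (hlim.mul_const ‖q m₀‖) hlim2 (by
    filter_upwards [hev, hev2] with k hk hk2
    have hk0 : (0 : ℝ) < k := by exact_mod_cast (by omega : 0 < k)
    have hk2' : 2 * (latticeLen m₀ : ℝ) + 1 ≤ k := by exact_mod_cast hk2
    have hhalf : 1 / 2 * (k : ℝ) ≤ latticeLen (x k) := by linarith [hxlen k]
    have h1 : (latticeLen (x k) : ℝ) ^ (-(s + ε)) ≤
        (1 / 2 : ℝ) ^ (-(s + ε)) * (k : ℝ) ^ (-(s + ε)) := by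
      rw [← Real.mul_rpow (by norm_num) hk0.le]
      exact Real.rpow_le_rpow_of_nonpos (by positivity) hhalf (by linarith)
    rw [Real.norm_of_nonneg (Real.rpow_nonneg (Nat.cast_nonneg _) _)] at hk
    have h2 : ‖q (x k)‖ ≤ |c| * ((1 / 2 : ℝ) ^ (-(s + ε)) * (k : ℝ) ^ (-(s + ε))) :=
      hk.trans (mul_le_mul (le_abs_self c) h1 (by positivity) (abs_nonneg c))
    have h3 := hlow (x k)
    rw [hxsub] at h3
    have hpow : (k : ℝ) ^ s * (k : ℝ) ^ (-(s + ε)) = (k : ℝ) ^ (-ε) := by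
      rw [← Real.rpow_add hk0]
      congr 1
      ring
    calc (k : ℝ) ^ s * J k * ‖q m₀‖ = (k : ℝ) ^ s * (J k * ‖q m₀‖) := by ring
      _ ≤ (k : ℝ) ^ s * ((S + ω) *
            (|c| * ((1 / 2 : ℝ) ^ (-(s + ε)) * (k : ℝ) ^ (-(s + ε))))) := by
          refine mul_le_mul_of_nonneg_left (h3.trans ?_) (by positivity)
          exact mul_le_mul_of_nonneg_left h2 (by positivity)
      _ = (S + ω) * |c| * (1 / 2 : ℝ) ^ (-(s + ε)) *
            ((k : ℝ) ^ s * (k : ℝ) ^ (-(s + ε))) := by ring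
      _ = _ := by rw [hpow])
  exact absurd hfin (not_le.2 (by positivity))

/-- A solution for a coupling of infinite order is eventually below every power of the length. -/
lemma SolvesStationary.isBigOWith_rpow (hJ : IsRadialCoupling d J) (hp : 1 < p) (hω : 0 < ω)
    (hord : HasOrderInfinity d J) {q : lp (fun _ : Fin d → ℤ => ℂ) 2}
    (hq : SolvesStationary J p ω q) {β : ℝ} (hβ : 0 < β) :
    IsBigOWith 1 cofinite (fun n : Fin d → ℤ => q n)
      (fun n : Fin d → ℤ => (latticeLen n : ℝ) ^ (-β)) := by
  have hd : (0 : ℝ) ≤ d := Nat.cast_nonneg d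
  -- The spare power of `|n|` absorbs the `β`-dependent constant `M` once `|n| ≥ |M|`, so the final
  -- constant is `1` for every `β`.
  obtain ⟨A, hA⟩ := exists_le_rpow_of_tendsto hJ.zero (hord (β + 1))
  obtain ⟨R, hR⟩ := exists_radius_norm_le q (ε := (ω / 2) ^ (p - 1)⁻¹) (by positivity)
  obtain ⟨C, hC⟩ := SolvesStationary.exists_decay hJ hp hω (by linarith) hA R
  have hbound := hC q hq hR
  set M := C * mass q ^ (p / 2)
  refine IsBigOWith.of_bound ?_
  have hlen := tendsto_natCast_atTop_atTop (R := ℝ) |>.comp (tendsto_latticeLen d)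
  filter_upwards [hlen.eventually_ge_atTop 1, hlen.eventually_ge_atTop |M|] with n h1 hM
  dsimp only [Function.comp_apply] at h1 hM
  have hpos : (0 : ℝ) < latticeLen n := by linarith
  rw [Real.norm_of_nonneg (by positivity), one_mul]
  have hbr : (latticeLen n : ℝ) ≤ bracket n := Real.le_sqrt_of_sq_le (by linarith)
  calc ‖q n‖ ≤ M * bracket n ^ (-((d : ℝ) + (β + 1))) := hbound n
    _ ≤ |M| * bracket n ^ (-((d : ℝ) + (β + 1))) :=
        mul_le_mul_of_nonneg_right (le_abs_self M) (Real.rpow_nonneg (bracket_pos n).le _)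
    _ ≤ (latticeLen n : ℝ) * (latticeLen n : ℝ) ^ (-(β + 1)) := by
        refine mul_le_mul hM ?_ (Real.rpow_nonneg (bracket_pos n).le _) hpos.le
        refine (Real.rpow_le_rpow_of_nonpos hpos hbr (by linarith)).trans ?_
        exact Real.rpow_le_rpow_of_exponent_le h1 (by linarith)
    _ = (latticeLen n : ℝ) ^ (-β) := by
        nth_rewrite 1 [← Real.rpow_one (latticeLen n : ℝ)]
        rw [← Real.rpow_add hpos]
        congr 1
        ring

end Stationary

theorem mainTheorem4 (d : ℕ) (hd : 1 ≤ d) (p : ℝ) (hp : 1 < p) (J : ℕ → ℝ)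
    (hJ : IsRadialCoupling d J) (ω : ℝ) (hω : 0 < ω) :
    -- finite order
    (∀ α : ℝ, 0 < α → HasOrder d J α →
      -- the decay estimate for each solution
      (∀ (ν : ℝ) (q : lp (fun _ : Fin d → ℤ => ℂ) 2), 0 < ν →
        SolvesStationary J p ω q → mass q = ν →
        ∃ C : ℝ, ∀ n : Fin d → ℤ,
          ‖q n‖ ≤ C * ν ^ (p / 2) * bracket n ^ (-((d : ℝ) + α))) ∧
      -- the constant depends on `q` only through a radius outside which `q` is small
      (∃ ε₀ : ℝ, 0 < ε₀ ∧ ∀ R : ℝ, ∃ C : ℝ,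
        ∀ (ν : ℝ) (q : lp (fun _ : Fin d → ℤ => ℂ) 2), 0 < ν →
          SolvesStationary J p ω q → mass q = ν →
          (∀ n : Fin d → ℤ, R < (latticeLen n : ℝ) → ‖q n‖ ≤ ε₀) →
          ∀ n : Fin d → ℤ,
            ‖q n‖ ≤ C * ν ^ (p / 2) * bracket n ^ (-((d : ℝ) + α))) ∧
      -- sharpness of the rate
      (∀ (ν : ℝ) (q : lp (fun _ : Fin d → ℤ => ℂ) 2), 0 < ν →
        SolvesStationary J p ω q → mass q = ν → HasNonnegEntries q →
        ∀ ε : ℝ, 0 < ε →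
          ¬ ((fun n : Fin d → ℤ => q n) =O[cofinite]
              (fun n : Fin d → ℤ => (latticeLen n : ℝ) ^ (-((d : ℝ) + α + ε)))))) ∧
    -- infinite order: decay faster than any power
    (HasOrderInfinity d J →
      ∀ (ν : ℝ) (q : lp (fun _ : Fin d → ℤ => ℂ) 2), 0 < ν →
        SolvesStationary J p ω q → mass q = ν →
        ∃ C : ℝ, ∀ β : ℝ, 0 < β →
          IsBigOWith C cofinite (fun n : Fin d → ℤ => q n)
            (fun n : Fin d → ℤ => (latticeLen n : ℝ) ^ (-β))) := by
  refine ⟨fun α hα hord => ?_, fun hord ν q _ hq _ =>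
    ⟨1, fun β hβ => hq.isBigOWith_rpow hJ hp hω hord hβ⟩⟩
  obtain ⟨A, hA0, hlim⟩ := hord
  obtain ⟨B, hB⟩ := exists_le_rpow_of_tendsto hJ.zero hlim
  have hs : (d : ℝ) < d + α := by linarith
  have hε₀ : 0 < (ω / 2) ^ (p - 1)⁻¹ := by positivity
  refine ⟨fun ν q _ hq hν => ?_, ⟨(ω / 2) ^ (p - 1)⁻¹, hε₀, fun R => ?_⟩,
    fun ν q hν0 hq hν hnn ε hε => ?_⟩
  · obtain ⟨R, hR⟩ := exists_radius_norm_le q hε₀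
    obtain ⟨C, hC⟩ := SolvesStationary.exists_decay hJ hp hω hs hB R
    exact ⟨C, hν ▸ hC q hq hR⟩
  · obtain ⟨C, hC⟩ := SolvesStationary.exists_decay hJ hp hω hs hB R
    exact ⟨C, fun ν q _ hq hν hR => hν ▸ hC q hq hR⟩
  · exact hq.not_isBigO hd hJ hω (by positivity) hA0 hlim (hν ▸ hν0) hnn hε
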